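/- Let $G$ be a subcomplex of the square lattice $\mathbb Z^2$ defined by a set of unit squares, any two of which are joined by a chain of squares of $G$ with consecutive squares sharing an edge. A ring is a pair of concentric circles with signed inner radius $r$ and outer radius $R>|r|$ (a positive $r$ means counter-clockwise, a negative $r$ clockwise orientation). An orthogonal ring pattern on $G$ assigns to each vertex $v_i$ of $G$ a ring in the plane, with inner circle $c_i$ and outer circle $C_i$, such that: (1) for neighbouring $v_i,v_j$ the circles $C_i,c_j$ intersect orthogonally, and so do $c_i,C_j$ (a circle of radius $0$ is a point, which is then required to lie on the other circle); (2) in each square of $G$ the circles $c_{m,n},c_{m+1,n+1},C_{m+1,n},C_{m,n+1}$ pass through one point $p$, at which the two outer circles touch with their centres on opposite sides of $p$; (3) for each of the four edges of such a square, the triangle formed by $p$ and the centres at the ends of the edge, taken in the cyclic order $(m,n),(m+1,n),(m+1,n+1),(m,n+1)$ of the square, is positively oriented, degenerate or negatively oriented according to whether $r>0$, $r=0$ or $r<0$ at that end of the edge whose inner circle passes through $p$. The pattern has area $\pi$ and $\rho$-radii $\rho_i\in\mathbb R$ if $r_i=\sinh\rho_i$ and $R_i=\cosh\rho_i$ for all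 vertices. An orthogonal (Schramm type) circle pattern on $G$ assigns to each vertex a circle of positive radius such that neighbouring circles intersect orthogonally and the four circles of each square pass through one point, about which their centres are arranged counter-clockwise in the above cyclic order. Its logarithmic radii are the logarithms of its radii; a dual pattern is an orthogonal circle pattern on $G$ with the reciprocal radii. The pattern with opposite orientation is the mirror image, with all circles oriented clockwise, i.e. with negative radii. Let $\mathcal R^\delta$, $\delta\in\mathbb R$, be a one parameter family of orthogonal ring patterns on $G$ of area $\pi$ with $\rho$-radii $\rho_i^\delta=\rho_i+\delta$. (If $G$ is simply connected, every orthogonal ring pattern of area $\pi$ with $\rho$-radii $\rho_i$ is the member $\mathcal R^0$ of such a family.) Then there are an orthogonal circle pattern $\mathcal C$ on $G$ with logarithmic radii $\rho_i$ and a dual pattern $\mathcal C^*$ of $\mathcal C$, with logarithmic radii $-\rho_i$, such that, after moving each $\mathcal R^\delta$ by a suitable orientation preserving Euclidean motion and scaling it by $2e^{-|\delta|}$, the following holds. As $\delta\to+\infty$ the rings collapse to the circles of $\mathcal C$: at each vertex the centres converge to the centre of the circle of $\mathcal C$, and both the inner and the outer radius converge to its radius $e^{\rho_i}$. As $\delta\to-\infty$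 the rings collapse to the circles of $\mathcal C^*$ with opposite orientation: at each vertex the centres converge to the centre of the mirror image of the circle of $\mathcal C^*$, the signed inner radius converges to $-e^{-\rho_i}$ and the outer radius to $e^{-\rho_i}$. -/

import Mathlib

open Filter Topology

noncomputable section

namespace RingPattern

/-! ### Subcomplexes of the square lattice -/

/-- The square lattice `ℤ²`: `(m, n)` is joined to `(m ± 1, n)` and to `(m, n ± 1)`. -/
def grid : SimpleGraph (ℤ × ℤ) where
  Adj i j := |i.1 - j.1| + |i.2 - j.2| = 1
  symm := ⟨fun i j h => by
    show |j.1 - i.1| + |j.2 - i.2| = 1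
    rw [abs_sub_comm j.1, abs_sub_comm j.2]; exact h⟩
  loopless := ⟨fun i h => by simp at h⟩

/-- The square with lower left vertex `Q = (m, n)`; its vertices are
`(m, n)`, `(m+1, n)`, `(m+1, n+1)`, `(m, n+1)`. -/
def corners (Q : ℤ × ℤ) : Set (ℤ × ℤ) :=
  {Q, (Q.1 + 1, Q.2), (Q.1 + 1, Q.2 + 1), (Q.1, Q.2 + 1)}

/-- Vertices of the subcomplex defined by a set `S` of squares. -/
def vertices (S : Set (ℤ × ℤ)) : Set (ℤ × ℤ) := {v | ∃ Q ∈ S, v ∈ corners Q}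

/-- Vertices and edges of the subcomplex defined by a set `S` of squares: the edges are the
edges of the squares in `S`. -/
def skeleton (S : Set (ℤ × ℤ)) : SimpleGraph (ℤ × ℤ) where
  Adj i j := grid.Adj i j ∧ ∃ Q ∈ S, i ∈ corners Q ∧ j ∈ corners Q
  symm := ⟨fun _ _ h => ⟨h.1.symm, h.2.imp fun _ hQ => ⟨hQ.1, hQ.2.2, hQ.2.1⟩⟩⟩
  loopless := ⟨fun _ h => grid.irrefl h.1⟩

/-- Any two squares of `S` are joined by a chain of squares of `S` in which consecutive squares
share an edge (two squares share an edge iff their lower left vertices are neighbours). -/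
def EdgeConnected (S : Set (ℤ × ℤ)) : Prop := (grid.induce S).Preconnected

/-- Edge path homotopy in the subcomplex defined by `S`: the congruence on edge paths for which
each closed path running along the boundary of a single square of `S` is trivial
(this includes the backtracking paths `i, j, i`). -/
inductive Homotopic (S : Set (ℤ × ℤ)) :
    ∀ {u v : ℤ × ℤ}, (skeleton S).Walk u v → (skeleton S).Walk u v → Prop
  | refl {u v : ℤ × ℤ} (p : (skeleton S).Walk u v) : Homotopic S p p
  | symm {u v : ℤ × ℤ} {p q : (skeleton S).Walk u v} : Homotopic S p q → Homotopic S q p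
  | trans {u v : ℤ × ℤ} {p q s : (skeleton S).Walk u v} :
      Homotopic S p q → Homotopic S q s → Homotopic S p s
  | append {u v w : ℤ × ℤ} {p p' : (skeleton S).Walk u v} {q q' : (skeleton S).Walk v w} :
      Homotopic S p p' → Homotopic S q q' → Homotopic S (p.append q) (p'.append q')
  | square {u : ℤ × ℤ} (Q : ℤ × ℤ) (hQ : Q ∈ S) (p : (skeleton S).Walk u u)
      (hp : ∀ x ∈ p.support, x ∈ corners Q) : Homotopic S p SimpleGraph.Walk.nil

/-- The subcomplex defined by `S` is simply connected: it is connected and each closed edge path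
is null-homotopic. -/
def SimplyConnected (S : Set (ℤ × ℤ)) : Prop :=
  (∀ u ∈ vertices S, ∀ v ∈ vertices S, (skeleton S).Reachable u v) ∧
    ∀ (u : ℤ × ℤ) (p : (skeleton S).Walk u u), Homotopic S p SimpleGraph.Walk.nil

/-! ### Circles and rings -/

/-- The circle with centre `z` and (signed) radius `r`; for `r = 0` it is the point `z`. -/
def circ (z : ℂ) (r : ℝ) : Set ℂ := Metric.sphere z |r|

/-- Two circles intersect orthogonally: they have a common point at which their radii (hence
their tangents) are perpendicular. If one of the radii vanishes, this says that the point
lies on the other circle. -/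
def OrthogonalCircles (z : ℂ) (r : ℝ) (w : ℂ) (s : ℝ) : Prop :=
  ∃ q ∈ circ z r ∩ circ w s, inner ℝ (q - z) (q - w) = 0

/-- Twice the signed area of the triangle `p, x, y`: positive iff `p, x, y` are in
counter-clockwise order, negative iff they are in clockwise order. -/
def area (p x y : ℂ) : ℝ :=
  (x - p).re * (y - p).im - (x - p).im * (y - p).re

/-- A ring at each lattice point: the centre, the signed radius of the inner circle and the
radius of the outer circle. -/
structure Rings where
  center : ℤ × ℤ → ℂ
  inner : ℤ × ℤ → ℝ
  outer : ℤ × ℤ → ℝ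

/-- An oriented circle at each lattice point; a positive radius stands for the
counter-clockwise, a negative radius for the clockwise orientation. -/
structure Circles where
  center : ℤ × ℤ → ℂ
  radius : ℤ × ℤ → ℝ

/-- The configuration of four rings of a square with vertices `i, j, k, l`
(lower left, lower right, upper right, upper left): the inner circles of `i`, `k` and the outer
circles of `j`, `l` pass through one point `p`, where the outer circles touch, and the
right-angled triangle formed by `p` and the ends of an edge is oriented by the ring whose
inner circle passes through `p`. Thus, if the inner radius of `i` is positive, the points
`c_i ∩ C_j ∖ {p}` (the mirror image of `p` in the line through the centres of `i` and `j`), `p`,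
`c_i ∩ C_l ∖ {p}` follow each other counter-clockwise on `c_i`, and clockwise if it is
negative; and the inner circles of `i`, `k` touch at `p` with their centres on different sides
of the common tangent iff their orientations agree. -/
def RingSquare (P : Rings) (i j k l : ℤ × ℤ) : Prop :=
  ∃ p : ℂ,
    p ∈ circ (P.center i) (P.inner i) ∧ p ∈ circ (P.center k) (P.inner k) ∧
    p ∈ circ (P.center j) (P.outer j) ∧ p ∈ circ (P.center l) (P.outer l) ∧
    p ∈ segment ℝ (P.center j) (P.center l) ∧
    SignType.sign (area p (P.center i) (P.center j)) = SignType.sign (P.inner i) ∧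
    SignType.sign (area p (P.center j) (P.center k)) = SignType.sign (P.inner k) ∧
    SignType.sign (area p (P.center k) (P.center l)) = SignType.sign (P.inner k) ∧
    SignType.sign (area p (P.center l) (P.center i)) = SignType.sign (P.inner i)

/-- Orthogonal ring patterns on the subcomplex defined by the set `S` of squares. -/
structure IsOrthogonalRingPattern (S : Set (ℤ × ℤ)) (P : Rings) : Prop where
  ring : ∀ v ∈ vertices S, |P.inner v| < P.outer v
  orthogonal : ∀ i j, (skeleton S).Adj i j →
    OrthogonalCircles (P.center i) (P.outer i) (P.center j) (P.inner j) ∧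
      OrthogonalCircles (P.center i) (P.inner i) (P.center j) (P.outer j)
  square : ∀ Q ∈ S, RingSquare P Q (Q.1 + 1, Q.2) (Q.1 + 1, Q.2 + 1) (Q.1, Q.2 + 1)

/-- The rings have area `π ℓ²` and `ρ`-radii `ρ`, that is
`r = ℓ sinh ρ` and `R = ℓ cosh ρ`. -/
def HasRhoRadii (S : Set (ℤ × ℤ)) (P : Rings) (ℓ : ℝ) (ρ : ℤ × ℤ → ℝ) : Prop :=
  ∀ v ∈ vertices S, P.inner v = ℓ * Real.sinh (ρ v) ∧ P.outer v = ℓ * Real.cosh (ρ v)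

/-- A one parameter family of orthogonal ring patterns of area `π` with
`ρ`-radii `ρ + δ`. -/
def IsRingFamily (S : Set (ℤ × ℤ)) (ρ : ℤ × ℤ → ℝ) (P : ℝ → Rings) : Prop :=
  ∀ δ : ℝ, IsOrthogonalRingPattern S (P δ) ∧ HasRhoRadii S (P δ) 1 (fun v => ρ v + δ)

/-- Orthogonal (Schramm type) circle patterns on the subcomplex defined by the set `S` of
squares: neighbouring circles intersect orthogonally, and the four circles of a square pass
through one point `p`, about which their centres are arranged counter-clockwise (so that, by
orthogonality, opposite circles of a square touch from outside at `p`). -/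
structure IsOrthogonalCirclePattern (S : Set (ℤ × ℤ)) (K : Circles) : Prop where
  pos : ∀ v ∈ vertices S, 0 < K.radius v
  orthogonal : ∀ i j, (skeleton S).Adj i j →
    OrthogonalCircles (K.center i) (K.radius i) (K.center j) (K.radius j)
  square : ∀ Q ∈ S, ∃ p : ℂ,
    (∀ v ∈ corners Q, p ∈ circ (K.center v) (K.radius v)) ∧
    0 < area p (K.center Q) (K.center (Q.1 + 1, Q.2)) ∧
    0 < area p (K.center (Q.1 + 1, Q.2)) (K.center (Q.1 + 1, Q.2 + 1)) ∧
    0 < area p (K.center (Q.1 + 1, Q.2 + 1)) (K.center (Q.1, Q.2 + 1)) ∧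
    0 < area p (K.center (Q.1, Q.2 + 1)) (K.center Q)

/-- The circles have logarithmic radii `ρ`. -/
def HasLogRadii (S : Set (ℤ × ℤ)) (K : Circles) (ρ : ℤ × ℤ → ℝ) : Prop :=
  ∀ v ∈ vertices S, K.radius v = Real.exp (ρ v)

/-- `K'` is a dual of the orthogonal circle pattern `K`: the orthogonal circle pattern on
the same complex with reciprocal radii. -/
def IsDual (S : Set (ℤ × ℤ)) (K K' : Circles) : Prop :=
  IsOrthogonalCirclePattern S K ∧ IsOrthogonalCirclePattern S K' ∧
    ∀ v ∈ vertices S, K'.radius v = (K.radius v)⁻¹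

/-- The pattern with opposite orientation: the mirror image, in which all circles run in the
opposite direction. -/
def Circles.reverse (K : Circles) : Circles where
  center v := starRingEnd ℂ (K.center v)
  radius v := -K.radius v

/-- The image of the rings under the orientation preserving Euclidean motion
`z ↦ u z + t`, `|u| = 1`. -/
def Rings.move (P : Rings) (u : Circle) (t : ℂ) : Rings where
  center v := u * P.center v + t
  inner := P.inner
  outer := P.outer

/-- The rings scaled by the factor `c`. -/
def Rings.scale (c : ℝ) (P : Rings) : Rings where
  center v := c * P.center v
  inner v := c * P.inner v
  outer v := c * P.outer v

/-- The rings `P δ` collapse to the oriented circles `K` along the filter `l`: at each vertex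
the centres converge, the signed inner radii converge to the signed radius of the circle, and
the outer radii converge to its absolute value. -/
def CollapsesTo (S : Set (ℤ × ℤ)) (l : Filter ℝ) (P : ℝ → Rings) (K : Circles) : Prop :=
  ∀ v ∈ vertices S,
    Tendsto (fun δ => (P δ).center v) l (𝓝 (K.center v)) ∧
    Tendsto (fun δ => (P δ).inner v) l (𝓝 (K.radius v)) ∧
    Tendsto (fun δ => (P δ).outer v) l (𝓝 |K.radius v|)

end RingPattern

end

/-! In a square with common point `p`, Pythagoras and the orientation conditions force the centres
onto two perpendicular lines through `p`: with a unit vector `e` they are `p + r e`, `p + i R e`, `p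
- r e`, `p - i R e` in cyclic order (`IsOrthogonalRingPattern.exists_frame`). Conversely, centres
placed in this way give ring patterns when `R² - r² = 1`, and circle patterns when `r = R > 0` (the
two `..._of_frames` lemmas).

The vector of an edge is thus `± i e (cosh b ± i sinh a)`, with `a`, `b` the `ρ`-radii of its ends,
and `cosh b + i sinh a` is a product of a function of `a + b` and a function of `a - b`
(`coshSinh_mul`). Shifting all `ρ`-radii by `δ` changes only the first function. So, up to a
rotation of the square, an edge vector is multiplied by a number that depends on the edge and not on
the square containing it (`IsFrame.sub_eq_shift`).

This has two consequences. On a simply connected complex the multiplied edge vectors close up around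
squares and integrate to a pattern with shifted radii (`exists_shifted_pattern`). In a given family,
squares sharing an edge turn by the same angle, so one rotation for each `δ` restores all directions
`e` to their values at `δ = 0` (`exists_common_rotation`).

With fixed directions and one common point held at the origin, the centres are determined by the
radii along chains of squares. The radii scaled by `2 exp (-|δ|)` tend to `exp ρ` for `δ → +∞`, and
to `∓ exp (-ρ)` (inner, outer) for `δ → -∞`. Hence the centres converge (`exists_limit_centers`) and
the limits are in standard position: directly for the circle pattern, after complex conjugation for
its dual. -/

open Complex ComplexConjugate

namespace RingPattern

/-! ### Squares in standard position -/

/-- The position of the vertex `v` of the square `Q` relative to the common point of its circles,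
where `e` is the direction from that point to the vertex `Q`. -/
def offset (Q : ℤ × ℤ) (e : ℂ) (r R : ℤ × ℤ → ℝ) (v : ℤ × ℤ) : ℂ :=
  if v.1 = Q.1 then (if v.2 = Q.2 then r v * e else -(R v * (I * e)))
  else (if v.2 = Q.2 then R v * (I * e) else -(r v * e))

/-- The centres at the vertices of the square `Q` are in standard position. -/
def IsFrame (Q : ℤ × ℤ) (p e : ℂ) (z : ℤ × ℤ → ℂ) (r R : ℤ × ℤ → ℝ) : Prop :=
  ∀ v ∈ corners Q, z v = p + offset Q e r R v

lemma forall_corners {Q : ℤ × ℤ} {T : ℤ × ℤ → Prop} :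
    (∀ v ∈ corners Q, T v) ↔
      T Q ∧ T (Q.1 + 1, Q.2) ∧ T (Q.1 + 1, Q.2 + 1) ∧ T (Q.1, Q.2 + 1) := by
  simp [corners]

lemma isFrame_iff {Q : ℤ × ℤ} {p e : ℂ} {z : ℤ × ℤ → ℂ} {r R : ℤ × ℤ → ℝ} :
    IsFrame Q p e z r R ↔
      z Q = p + r Q * e ∧ z (Q.1 + 1, Q.2) = p + R (Q.1 + 1, Q.2) * (I * e) ∧
      z (Q.1 + 1, Q.2 + 1) = p - r (Q.1 + 1, Q.2 + 1) * e ∧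
      z (Q.1, Q.2 + 1) = p - R (Q.1, Q.2 + 1) * (I * e) := by
  rw [IsFrame, forall_corners]
  simp [offset, sub_eq_add_neg]

lemma offset_mul (Q : ℤ × ℤ) (u e : ℂ) (r R : ℤ × ℤ → ℝ) (v : ℤ × ℤ) :
    offset Q (u * e) r R v = u * offset Q e r R v := by
  unfold offset; split_ifs <;> ring

lemma offset_congr {Q : ℤ × ℤ} {e : ℂ} {r R r' R' : ℤ × ℤ → ℝ} {v : ℤ × ℤ}
    (hr : r v = r' v) (hR : R v = R' v) : offset Q e r R v = offset Q e r' R' v := by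
  simp [offset, hr, hR]

lemma tendsto_offset {l : Filter ℝ} {c : ℝ → ℝ} {r R : ℝ → ℤ × ℤ → ℝ} {a b : ℤ × ℤ → ℝ}
    {v : ℤ × ℤ} (Q : ℤ × ℤ) (e : ℂ) (hr : Tendsto (fun δ => c δ * r δ v) l (𝓝 (a v)))
    (hR : Tendsto (fun δ => c δ * R δ v) l (𝓝 (b v))) :
    Tendsto (fun δ => (c δ : ℂ) * offset Q e (r δ) (R δ) v) l (𝓝 (offset Q e a b v)) := by
  have hr' : Tendsto (fun δ => (c δ : ℂ) * (r δ v : ℂ)) l (𝓝 (a v : ℂ)) := by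
    simpa [Function.comp_def] using (continuous_ofReal.tendsto _).comp hr
  have hR' : Tendsto (fun δ => (c δ : ℂ) * (R δ v : ℂ)) l (𝓝 (b v : ℂ)) := by
    simpa [Function.comp_def] using (continuous_ofReal.tendsto _).comp hR
  unfold offset
  split_ifs
  · simpa only [mul_assoc] using hr'.mul_const e
  · simpa only [mul_assoc, mul_neg] using (hR'.mul_const (I * e)).neg
  · simpa only [mul_assoc] using hR'.mul_const (I * e)
  · simpa only [mul_assoc, mul_neg] using (hr'.mul_const e).neg

lemma corners_subset_vertices {S : Set (ℤ × ℤ)} {Q v : ℤ × ℤ} (hQ : Q ∈ S)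
    (hv : v ∈ corners Q) : v ∈ vertices S := ⟨Q, hQ, hv⟩

/-- The eight oriented edges of a square. -/
lemma edge_cases {Q v w : ℤ × ℤ} (hv : v ∈ corners Q) (hw : w ∈ corners Q)
    (h : grid.Adj v w) {T : ℤ × ℤ → ℤ × ℤ → Prop} (symm : ∀ x y, T x y → T y x)
    (h₁ : T Q (Q.1 + 1, Q.2)) (h₂ : T (Q.1 + 1, Q.2 + 1) (Q.1 + 1, Q.2))
    (h₃ : T (Q.1 + 1, Q.2 + 1) (Q.1, Q.2 + 1)) (h₄ : T Q (Q.1, Q.2 + 1)) : T v w := by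
  simp only [corners, Set.mem_insert_iff, Set.mem_singleton_iff] at hv hw
  rcases hv with rfl | rfl | rfl | rfl <;> rcases hw with rfl | rfl | rfl | rfl <;>
    first
    | assumption
    | exact symm _ _ (by assumption)
    | (exfalso; simp [grid] at h)

lemma exists_shared_edge {Q Q' : ℤ × ℤ} (h : grid.Adj Q Q') :
    ∃ v w, grid.Adj v w ∧ v ∈ corners Q ∧ w ∈ corners Q ∧ v ∈ corners Q' ∧ w ∈ corners Q' := by
  obtain ⟨a, b⟩ := Q
  obtain ⟨a', b'⟩ := Q'
  have h' : |a - a'| + |b - b'| = 1 := h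
  have : (a' = a + 1 ∧ b' = b) ∨ (a' = a - 1 ∧ b' = b) ∨ (a' = a ∧ b' = b + 1) ∨
      (a' = a ∧ b' = b - 1) := by
    rcases abs_cases (a - a') with ⟨h1, _⟩ | ⟨h1, _⟩ <;>
      rcases abs_cases (b - b') with ⟨h2, _⟩ | ⟨h2, _⟩ <;> omega
  rcases this with ⟨rfl, rfl⟩ | ⟨rfl, rfl⟩ | ⟨rfl, rfl⟩ | ⟨rfl, rfl⟩
  · exact ⟨(a + 1, b'), (a + 1, b' + 1), by simp [grid], by simp [corners]⟩
  · exact ⟨(a, b'), (a, b' + 1), by simp [grid], by simp [corners]⟩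
  · exact ⟨(a', b + 1), (a' + 1, b + 1), by simp [grid], by simp [corners]⟩
  · exact ⟨(a', b), (a' + 1, b), by simp [grid], by simp [corners]⟩

lemma EdgeConnected.induction {S : Set (ℤ × ℤ)} (hS : EdgeConnected S) {Q₀ : ℤ × ℤ}
    (hQ₀ : Q₀ ∈ S) {T : ℤ × ℤ → Prop} (base : T Q₀)
    (step : ∀ Q ∈ S, ∀ Q' ∈ S, grid.Adj Q Q' → T Q → T Q') : ∀ Q ∈ S, T Q := by
  intro Q hQ
  obtain ⟨W⟩ := hS ⟨Q₀, hQ₀⟩ ⟨Q, hQ⟩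
  have key : ∀ (x y : S), (grid.induce S).Walk x y → T x → T y := by
    intro x y W
    induction W with
    | nil => exact id
    | cons h _ ih => exact fun hx => ih (step _ (Subtype.coe_prop _) _ (Subtype.coe_prop _) h hx)
  exact key _ _ W base

/-! ### Orthogonal circles and frames -/

lemma OrthogonalCircles.norm_sub_sq {z w : ℂ} {r s : ℝ} (h : OrthogonalCircles z r w s) :
    ‖z - w‖ ^ 2 = r ^ 2 + s ^ 2 := by
  obtain ⟨q, ⟨h₁, h₂⟩, h₃⟩ := h
  have h₁' : ‖q - z‖ = |r| := by simpa [circ, dist_eq_norm] using h₁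
  have h₂' : ‖q - w‖ = |s| := by simpa [circ, dist_eq_norm] using h₂
  have : z - w = (q - w) - (q - z) := by ring
  rw [this, norm_sub_sq_real, real_inner_comm, h₃, h₁', h₂', sq_abs, sq_abs]
  simp; ring

/-- Converse of Pythagoras: `w - z` has the length of `r + i s`, so it is `u (r + i s)` with `|u| =
1`, and `z + u r` is the vertex of the right angle. -/
lemma orthogonalCircles_of_norm_sub_sq {z w : ℂ} {r s : ℝ} (hr : 0 < r ^ 2 + s ^ 2)
    (h : ‖z - w‖ ^ 2 = r ^ 2 + s ^ 2) : OrthogonalCircles z r w s := by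
  have hN : ((r : ℂ) + s * I) ≠ 0 := by
    intro h0
    have := congrArg Complex.normSq h0
    rw [Complex.normSq_add_mul_I, map_zero] at this
    exact hr.ne' this
  have hn : ‖(r : ℂ) + s * I‖ ^ 2 = r ^ 2 + s ^ 2 := by
    rw [← Complex.normSq_eq_norm_sq, Complex.normSq_add_mul_I]
  obtain ⟨u, hu⟩ : ∃ u : ℂ, w - z = u * (r + s * I) := ⟨(w - z) / (r + s * I), by field_simp⟩
  have hu1 : ‖u‖ = 1 := by
    have : ‖u‖ ^ 2 * (r ^ 2 + s ^ 2) = 1 * (r ^ 2 + s ^ 2) := by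
      rw [← hn, ← mul_pow, ← norm_mul, ← hu, norm_sub_rev, h, hn, one_mul]
    have := mul_right_cancel₀ hr.ne' this
    exact (pow_eq_one_iff_of_nonneg (norm_nonneg u) two_ne_zero).1 this
  have hq : z + u * r - w = -(u * (s * I)) := by linear_combination -hu
  have hu2 : u.re * u.re + u.im * u.im = 1 := by
    rw [← Complex.normSq_apply, Complex.normSq_eq_norm_sq, hu1, one_pow]
  refine ⟨z + u * r, ⟨?_, ?_⟩, ?_⟩
  · simp [circ, hu1]
  · simp [circ, hq, hu1]
  · rw [hq, add_sub_cancel_left, Complex.inner]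
    simp
    ring

/-- Pythagoras for the triangle `0, x, i R e` puts the right angle at `0`. -/
lemma eq_real_mul_of_perp {x e : ℂ} {R : ℝ} (he : ‖e‖ = 1) (hR : R ≠ 0)
    (h : ‖x - R * (I * e)‖ ^ 2 = ‖x‖ ^ 2 + R ^ 2) : ∃ s : ℝ, x = s * e := by
  have he2 : e.re * e.re + e.im * e.im = 1 := by
    rw [← Complex.normSq_apply, Complex.normSq_eq_norm_sq, he, one_pow]
  rw [← Complex.normSq_eq_norm_sq, ← Complex.normSq_eq_norm_sq, Complex.normSq_apply,
    Complex.normSq_apply] at h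
  simp at h
  have h0 : x.im * e.re - x.re * e.im = 0 := by
    have : R * (x.im * e.re - x.re * e.im) = 0 := by linear_combination (-1/2) * h + R^2/2 * he2
    exact (mul_eq_zero.1 this).resolve_left hR
  refine ⟨x.re * e.re + x.im * e.im, ?_⟩
  apply Complex.ext
  · simp; linear_combination (-x.re) * he2 - e.im * h0
  · simp; linear_combination (-x.im) * he2 + e.re * h0

lemma real_eq_of_abs_eq_of_sign_mul_eq {s r R : ℝ} (hR : 0 < R) (h : |s| = |r|)
    (hs : SignType.sign (s * R) = SignType.sign r) : s = r := by
  rw [sign_mul, sign_pos hR, mul_one] at hs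
  rw [← sign_mul_abs s, ← sign_mul_abs r, hs, h]

lemma area_eq {p x y e : ℂ} {s R : ℝ} (he : ‖e‖ = 1) (hx : x = p + s * e)
    (hy : y = p + R * (I * e)) : area p x y = s * R := by
  have he2 : e.re * e.re + e.im * e.im = 1 := by
    rw [← Complex.normSq_apply, Complex.normSq_eq_norm_sq, he, one_pow]
  subst hx hy
  simp [area]
  linear_combination s * R * he2

lemma area_swap (p x y : ℂ) : area p y x = -area p x y := by
  simp [area]; ring

lemma RingSquare.exists_frame {P : Rings} {Q : ℤ × ℤ}
    (h : RingSquare P Q (Q.1 + 1, Q.2) (Q.1 + 1, Q.2 + 1) (Q.1, Q.2 + 1))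
    (hj : 0 < P.outer (Q.1 + 1, Q.2)) (hl : 0 < P.outer (Q.1, Q.2 + 1))
    (hij : OrthogonalCircles (P.center Q) (P.inner Q) (P.center (Q.1 + 1, Q.2))
      (P.outer (Q.1 + 1, Q.2)))
    (hkj : OrthogonalCircles (P.center (Q.1 + 1, Q.2 + 1)) (P.inner (Q.1 + 1, Q.2 + 1))
      (P.center (Q.1 + 1, Q.2)) (P.outer (Q.1 + 1, Q.2))) :
    ∃ p e : ℂ, ‖e‖ = 1 ∧ IsFrame Q p e P.center P.inner P.outer := by
  obtain ⟨p, pi, pk, pj, pl, hseg, ai, ak, -, -⟩ := h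
  set j : ℤ × ℤ := (Q.1 + 1, Q.2)
  set k : ℤ × ℤ := (Q.1 + 1, Q.2 + 1)
  set l : ℤ × ℤ := (Q.1, Q.2 + 1)
  have pi' : ‖P.center Q - p‖ = |P.inner Q| := by
    rw [norm_sub_rev]; simpa [circ, dist_eq_norm] using pi
  have pk' : ‖P.center k - p‖ = |P.inner k| := by
    rw [norm_sub_rev]; simpa [circ, dist_eq_norm] using pk
  have pj' : ‖P.center j - p‖ = P.outer j := by
    rw [norm_sub_rev]; simpa [circ, dist_eq_norm, abs_of_pos hj] using pj
  have pl' : ‖P.center l - p‖ = P.outer l := by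
    rw [norm_sub_rev]; simpa [circ, dist_eq_norm, abs_of_pos hl] using pl
  have hjC : (P.outer j : ℂ) ≠ 0 := by exact_mod_cast hj.ne'
  -- The direction is read off from the outer circle of `j`, whose radius cannot vanish; an inner
  -- radius may.
  obtain ⟨e, he⟩ : ∃ e : ℂ, P.center j - p = P.outer j * (I * e) :=
    ⟨-I * (P.center j - p) / P.outer j, by field_simp; linear_combination (P.center j - p) * I_sq⟩
  have he1 : ‖e‖ = 1 := by
    have h1 : P.outer j * ‖e‖ = P.outer j * 1 := by
      rw [mul_one]
      nth_rewrite 2 [← pj']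
      rw [he, norm_mul, norm_mul, norm_I, one_mul, norm_real,
        Real.norm_of_nonneg hj.le]
    exact mul_left_cancel₀ hj.ne' h1
  have perp : ∀ v : ℤ × ℤ, ‖P.center v - p‖ = |P.inner v| →
      OrthogonalCircles (P.center v) (P.inner v) (P.center j) (P.outer j) →
      ∃ s : ℝ, P.center v - p = s * e ∧ |s| = |P.inner v| := by
    intro v hv ho
    obtain ⟨s, hs⟩ := eq_real_mul_of_perp (x := P.center v - p) he1 hj.ne' (by
      rw [← he, sub_sub_sub_cancel_right, ho.norm_sub_sq, hv, sq_abs])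
    refine ⟨s, hs, ?_⟩
    rw [← hv, hs, norm_mul, he1, mul_one, norm_real, Real.norm_eq_abs]
  have hzj : P.center j = p + P.outer j * (I * e) := by linear_combination he
  have hzi : P.center Q = p + P.inner Q * e := by
    obtain ⟨s, hs, hs'⟩ := perp Q pi' hij
    have hz : P.center Q = p + s * e := by linear_combination hs
    rw [area_eq he1 hz hzj] at ai
    rw [hz, real_eq_of_abs_eq_of_sign_mul_eq hj hs' ai]
  have hzk : P.center k = p - P.inner k * e := by
    obtain ⟨s, hs, hs'⟩ := perp k pk' hkj
    have hz : P.center k = p + s * e := by linear_combination hs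
    -- Seen from `p`, the vertex `k` follows `j` whereas `Q` precedes it; this reverses the sign, so
    -- `k` sits at minus its signed radius.
    rw [area_swap, area_eq he1 hz hzj, ← neg_mul] at ak
    rw [← abs_neg] at hs'
    rw [hz, ← real_eq_of_abs_eq_of_sign_mul_eq hj hs' ak]
    push_cast; ring
  have hzl : P.center l = p - P.outer l * (I * e) := by
    -- As `p` lies between the outer centres, the vectors from `p` to them are opposite multiples of
    -- one vector, in the ratio of the outer radii.
    rw [segment_eq_image'] at hseg
    obtain ⟨θ, ⟨h0, h1⟩, hp⟩ := hseg
    simp only [real_smul] at hp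
    have hjp : P.center j - p = -(θ * (P.center l - P.center j)) := by linear_combination hp
    have hlp : P.center l - p = ((1 - θ : ℝ) : ℂ) * (P.center l - P.center j) := by
      push_cast; linear_combination hp
    have nj : P.outer j = θ * ‖P.center l - P.center j‖ := by
      rw [← pj', hjp, norm_neg, norm_mul, norm_real, Real.norm_of_nonneg h0]
    have nl : P.outer l = (1 - θ) * ‖P.center l - P.center j‖ := by
      rw [← pl', hlp, norm_mul, norm_real, Real.norm_of_nonneg (by linarith)]
    have key : (P.outer j : ℂ) * (P.center l - p) = -(P.outer l * (P.center j - p)) := by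
      rw [hjp, hlp, nj, nl]; push_cast; ring
    rw [he] at key
    have : P.center l - p = -(P.outer l * (I * e)) := by
      apply mul_left_cancel₀ hjC
      linear_combination key
    linear_combination this
  exact ⟨p, e, he1, isFrame_iff.2 ⟨hzi, hzj, hzk, hzl⟩⟩

lemma IsOrthogonalRingPattern.exists_frame {S : Set (ℤ × ℤ)} {P : Rings}
    (hP : IsOrthogonalRingPattern S P) {Q : ℤ × ℤ} (hQ : Q ∈ S) :
    ∃ p e : ℂ, ‖e‖ = 1 ∧ IsFrame Q p e P.center P.inner P.outer := by
  have pos : ∀ v ∈ corners Q, 0 < P.outer v := fun v hv =>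
    (abs_nonneg _).trans_lt (hP.ring v (corners_subset_vertices hQ hv))
  have orth : ∀ v ∈ corners Q, ∀ w ∈ corners Q, grid.Adj v w →
      OrthogonalCircles (P.center v) (P.inner v) (P.center w) (P.outer w) :=
    fun v hv w hw h => (hP.orthogonal v w ⟨h, Q, hQ, hv, hw⟩).2
  exact (hP.square Q hQ).exists_frame (pos _ (by simp [corners])) (pos _ (by simp [corners]))
    (orth _ (by simp [corners]) _ (by simp [corners]) (by simp [grid]))
    (orth _ (by simp [corners]) _ (by simp [corners]) (by simp [grid]))

lemma IsFrame.ringSquare {P : Rings} {Q : ℤ × ℤ} {p e : ℂ} (he : ‖e‖ = 1)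
    (h : IsFrame Q p e P.center P.inner P.outer)
    (hj : 0 < P.outer (Q.1 + 1, Q.2)) (hl : 0 < P.outer (Q.1, Q.2 + 1)) :
    RingSquare P Q (Q.1 + 1, Q.2) (Q.1 + 1, Q.2 + 1) (Q.1, Q.2 + 1) := by
  obtain ⟨hzi, hzj, hzk, hzl⟩ := isFrame_iff.1 h
  set j : ℤ × ℤ := (Q.1 + 1, Q.2)
  set k : ℤ × ℤ := (Q.1 + 1, Q.2 + 1)
  set l : ℤ × ℤ := (Q.1, Q.2 + 1)
  have hzk' : P.center k = p + ((-P.inner k : ℝ) : ℂ) * e := by rw [hzk]; push_cast; ring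
  have hzl' : P.center l = p + ((-P.outer l : ℝ) : ℂ) * (I * e) := by rw [hzl]; push_cast; ring
  refine ⟨p, ?_, ?_, ?_, ?_, ?_, ?_, ?_, ?_, ?_⟩
  · simp [circ, hzi, he]
  · simp [circ, hzk, he]
  · simp [circ, hzj, he]
  · simp [circ, hzl, he]
  · have hs : 0 < P.outer j + P.outer l := by positivity
    have hsC : (P.outer j + P.outer l : ℂ) ≠ 0 := by exact_mod_cast hs.ne'
    refine ⟨P.outer l / (P.outer j + P.outer l), P.outer j / (P.outer j + P.outer l),
      by positivity, by positivity, by field_simp; ring, ?_⟩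
    rw [hzj, hzl]
    simp only [real_smul]
    push_cast
    field_simp
    ring
  · rw [area_eq he hzi hzj, sign_mul, sign_pos hj, mul_one]
  · rw [area_swap, area_eq he hzk' hzj, neg_mul, neg_neg, sign_mul, sign_pos hj, mul_one]
  · rw [area_eq he hzk' hzl', neg_mul_neg, sign_mul, sign_pos hl, mul_one]
  · rw [area_swap, area_eq he hzi hzl', mul_neg, neg_neg, sign_mul, sign_pos hl, mul_one]

lemma norm_sub_sq_of_frame {e : ℂ} (he : ‖e‖ = 1) (p : ℂ) (s R : ℝ) :
    ‖(p + s * e) - (p + R * (I * e))‖ ^ 2 = s ^ 2 + R ^ 2 := by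
  have : (p + s * e) - (p + R * (I * e)) = e * ((s : ℂ) + (-R : ℝ) * I) := by push_cast; ring
  rw [this, norm_mul, he, one_mul, ← Complex.normSq_eq_norm_sq, Complex.normSq_add_mul_I]
  ring

/-- Rings of equal area in standard position form an orthogonal ring pattern. -/
lemma isOrthogonalRingPattern_of_frames {S : Set (ℤ × ℤ)} {P : Rings}
    (area_eq : ∀ v ∈ vertices S, P.outer v ^ 2 - P.inner v ^ 2 = 1)
    (pos : ∀ v ∈ vertices S, 0 < P.outer v)
    (frame : ∀ Q ∈ S, ∃ p e : ℂ, ‖e‖ = 1 ∧ IsFrame Q p e P.center P.inner P.outer) :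
    IsOrthogonalRingPattern S P where
  ring v hv := abs_lt_of_sq_lt_sq (by linarith [area_eq v hv]) (pos v hv).le
  orthogonal i j hij := by
    obtain ⟨h, Q, hQ, hi, hj⟩ := hij
    obtain ⟨p, e, he, hF⟩ := frame Q hQ
    obtain ⟨hzi, hzj, hzk, hzl⟩ := isFrame_iff.1 hF
    -- Equal areas give `r_x² + R_y² = R_x² + r_y²`, so a single distance yields both orthogonality
    -- conditions.
    have main : ∀ x y : ℤ × ℤ, x ∈ vertices S → y ∈ vertices S →
        ‖P.center x - P.center y‖ ^ 2 = P.inner x ^ 2 + P.outer y ^ 2 →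
        OrthogonalCircles (P.center x) (P.outer x) (P.center y) (P.inner y) ∧
          OrthogonalCircles (P.center x) (P.inner x) (P.center y) (P.outer y) := by
      intro x y hx hy hxy
      have := pos x hx
      have := pos y hy
      exact ⟨orthogonalCircles_of_norm_sub_sq (by positivity)
        (by linarith [area_eq x hx, area_eq y hy]),
        orthogonalCircles_of_norm_sub_sq (by positivity) hxy⟩
    have hV : ∀ v ∈ corners Q, v ∈ vertices S := fun v hv => corners_subset_vertices hQ hv
    rw [forall_corners] at hV
    obtain ⟨vi, vj, vk, vl⟩ := hV
    have hzk' : P.center (Q.1 + 1, Q.2 + 1) =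
        p + ((-P.inner (Q.1 + 1, Q.2 + 1) : ℝ) : ℂ) * e := by rw [hzk]; push_cast; ring
    have hzl' : P.center (Q.1, Q.2 + 1) =
        p + ((-P.outer (Q.1, Q.2 + 1) : ℝ) : ℂ) * (I * e) := by rw [hzl]; push_cast; ring
    refine edge_cases hi hj h (T := fun x y =>
        OrthogonalCircles (P.center x) (P.outer x) (P.center y) (P.inner y) ∧
          OrthogonalCircles (P.center x) (P.inner x) (P.center y) (P.outer y)) ?_
      (main _ _ vi vj ?_) (main _ _ vk vj ?_) (main _ _ vk vl ?_) (main _ _ vi vl ?_)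
    · rintro x y ⟨⟨q, hq, h1⟩, q', hq', h2⟩
      exact ⟨⟨q', hq'.symm, by rw [real_inner_comm]; exact h2⟩,
        q, hq.symm, by rw [real_inner_comm]; exact h1⟩
    · rw [hzi, hzj, norm_sub_sq_of_frame he]
    · rw [hzk', hzj, norm_sub_sq_of_frame he, neg_sq]
    · rw [hzk', hzl', norm_sub_sq_of_frame he, neg_sq, neg_sq]
    · rw [hzi, hzl', norm_sub_sq_of_frame he, neg_sq]
  square Q hQ := by
    obtain ⟨p, e, he, hF⟩ := frame Q hQ
    exact hF.ringSquare he (pos _ (corners_subset_vertices hQ (by simp [corners])))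
      (pos _ (corners_subset_vertices hQ (by simp [corners])))

/-- Circles with the centres in standard position form an orthogonal circle pattern. -/
lemma isOrthogonalCirclePattern_of_frames {S : Set (ℤ × ℤ)} {K : Circles}
    (pos : ∀ v ∈ vertices S, 0 < K.radius v)
    (frame : ∀ Q ∈ S, ∃ p e : ℂ, ‖e‖ = 1 ∧ IsFrame Q p e K.center K.radius K.radius) :
    IsOrthogonalCirclePattern S K where
  pos := pos
  orthogonal i j hij := by
    obtain ⟨h, Q, hQ, hi, hj⟩ := hij
    obtain ⟨p, e, he, hF⟩ := frame Q hQ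
    obtain ⟨hzi, hzj, hzk, hzl⟩ := isFrame_iff.1 hF
    have hV : ∀ v ∈ corners Q, 0 < K.radius v :=
      fun v hv => pos v (corners_subset_vertices hQ hv)
    rw [forall_corners] at hV
    obtain ⟨vi, vj, vk, vl⟩ := hV
    have hzk' : K.center (Q.1 + 1, Q.2 + 1) =
        p + ((-K.radius (Q.1 + 1, Q.2 + 1) : ℝ) : ℂ) * e := by rw [hzk]; push_cast; ring
    have hzl' : K.center (Q.1, Q.2 + 1) =
        p + ((-K.radius (Q.1, Q.2 + 1) : ℝ) : ℂ) * (I * e) := by rw [hzl]; push_cast; ring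
    refine edge_cases hi hj h (T := fun x y =>
        OrthogonalCircles (K.center x) (K.radius x) (K.center y) (K.radius y)) ?_
      (orthogonalCircles_of_norm_sub_sq (by positivity) ?_)
      (orthogonalCircles_of_norm_sub_sq (by positivity) ?_)
      (orthogonalCircles_of_norm_sub_sq (by positivity) ?_)
      (orthogonalCircles_of_norm_sub_sq (by positivity) ?_)
    · rintro x y ⟨q, hq, h1⟩
      exact ⟨q, hq.symm, by rw [real_inner_comm]; exact h1⟩
    · rw [hzi, hzj, norm_sub_sq_of_frame he]
    · rw [hzk', hzj, norm_sub_sq_of_frame he, neg_sq]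
    · rw [hzk', hzl', norm_sub_sq_of_frame he, neg_sq, neg_sq]
    · rw [hzi, hzl', norm_sub_sq_of_frame he, neg_sq]
  square Q hQ := by
    obtain ⟨p, e, he, hF⟩ := frame Q hQ
    obtain ⟨hzi, hzj, hzk, hzl⟩ := isFrame_iff.1 hF
    have hV : ∀ v ∈ corners Q, 0 < K.radius v :=
      fun v hv => pos v (corners_subset_vertices hQ hv)
    rw [forall_corners] at hV
    obtain ⟨vi, vj, vk, vl⟩ := hV
    have hzk' : K.center (Q.1 + 1, Q.2 + 1) =
        p + ((-K.radius (Q.1 + 1, Q.2 + 1) : ℝ) : ℂ) * e := by rw [hzk]; push_cast; ring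
    have hzl' : K.center (Q.1, Q.2 + 1) =
        p + ((-K.radius (Q.1, Q.2 + 1) : ℝ) : ℂ) * (I * e) := by rw [hzl]; push_cast; ring
    refine ⟨p, ?_, ?_, ?_, ?_, ?_⟩
    · rw [forall_corners]
      refine ⟨?_, ?_, ?_, ?_⟩
      · simp [circ, hzi, he]
      · simp [circ, hzj, he]
      · simp [circ, hzk, he]
      · simp [circ, hzl, he]
    · rw [area_eq he hzi hzj]; positivity
    · rw [area_swap, area_eq he hzk' hzj, neg_mul, neg_neg]; positivity
    · rw [area_eq he hzk' hzl', neg_mul_neg]; positivity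
    · rw [area_swap, area_eq he hzi hzl', mul_neg, neg_neg]; positivity

/-! ### The shift of the `ρ`-radii -/

/-- The complex number `cosh t + i sinh t`. -/
noncomputable def coshSinh (t : ℝ) : ℂ := Real.cosh t + Real.sinh t * I

lemma coshSinh_ne_zero (t : ℝ) : coshSinh t ≠ 0 := fun h => by
  have := congrArg Complex.re h
  simp only [coshSinh, add_re, ofReal_re, mul_re, I_re, ofReal_im, I_im, zero_re] at this
  linarith [Real.cosh_pos t]

/-- Addition theorems for `s = (a + b) / 2` and `d = (a - b) / 2`. A common shift of `a` and `b`
moves `s` and leaves `d` fixed. -/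
lemma coshSinh_mul (a b : ℝ) :
    coshSinh ((a + b) / 2) * coshSinh ((a - b) / 2) = Real.cosh b + Real.sinh a * I := by
  have ha : a = (a + b) / 2 + (a - b) / 2 := by ring
  have hb : b = (a + b) / 2 - (a - b) / 2 := by ring
  have h1 : Real.sinh a = _ := (congrArg Real.sinh ha).trans (Real.sinh_add _ _)
  have h2 : Real.cosh b = _ := (congrArg Real.cosh hb).trans (Real.cosh_sub _ _)
  rw [h1, h2, coshSinh, coshSinh]
  push_cast
  linear_combination (Complex.sinh ((a + b) / 2) * Complex.sinh ((a - b) / 2)) * I_sq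

/-- The factor by which the vector of an edge of a square in standard position changes
when all `ρ`-radii are shifted by `δ`. -/
noncomputable def edgeFactor (ρ : ℤ × ℤ → ℝ) (δ : ℝ) (v w : ℤ × ℤ) : ℂ :=
  if v.2 = w.2 then coshSinh ((ρ v + ρ w) / 2 + δ) / coshSinh ((ρ v + ρ w) / 2)
  else conj (coshSinh ((ρ v + ρ w) / 2 + δ) / coshSinh ((ρ v + ρ w) / 2))

lemma edgeFactor_comm (ρ : ℤ × ℤ → ℝ) (δ : ℝ) (v w : ℤ × ℤ) :
    edgeFactor ρ δ v w = edgeFactor ρ δ w v := by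
  simp only [edgeFactor, eq_comm (a := v.2), add_comm (ρ v)]

lemma coshSinh_div_mul (a b δ : ℝ) :
    coshSinh ((a + b) / 2 + δ) / coshSinh ((a + b) / 2) * (Real.cosh b + Real.sinh a * I) =
      Real.cosh (b + δ) + Real.sinh (a + δ) * I := by
  rw [← coshSinh_mul a b, ← coshSinh_mul (a + δ) (b + δ),
    show (a + δ + (b + δ)) / 2 = (a + b) / 2 + δ by ring,
    show (a + δ - (b + δ)) / 2 = (a - b) / 2 by ring]
  have := coshSinh_ne_zero ((a + b) / 2)
  field_simp

lemma conj_coshSinh_div_mul (a b δ : ℝ) :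
    conj (coshSinh ((a + b) / 2 + δ) / coshSinh ((a + b) / 2)) *
      (Real.cosh b - Real.sinh a * I) = Real.cosh (b + δ) - Real.sinh (a + δ) * I := by
  have := congrArg conj (coshSinh_div_mul a b δ)
  simpa only [map_mul, map_add, conj_ofReal, conj_I, mul_neg, ← sub_eq_add_neg] using this

/-- Horizontal edge vectors are `± i e (cosh b + i sinh a)` and vertical ones `± i e (cosh b - i
sinh a)`, hence the conjugate in `edgeFactor`. In the two squares at an edge the inner and outer
roles of its ends are exchanged, but the factor depends only on the sum of their `ρ`-radii. -/
lemma offset_sub_offset_shift (ρ : ℤ × ℤ → ℝ) (δ : ℝ) (e : ℂ) {Q v w : ℤ × ℤ}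
    (hv : v ∈ corners Q) (hw : w ∈ corners Q) (h : grid.Adj v w) :
    offset Q e (fun x => Real.sinh (ρ x + δ)) (fun x => Real.cosh (ρ x + δ)) w -
      offset Q e (fun x => Real.sinh (ρ x + δ)) (fun x => Real.cosh (ρ x + δ)) v =
    edgeFactor ρ δ v w * (offset Q e (fun x => Real.sinh (ρ x)) (fun x => Real.cosh (ρ x)) w -
      offset Q e (fun x => Real.sinh (ρ x)) (fun x => Real.cosh (ρ x)) v) := by
  refine edge_cases hv hw h (T := fun v w =>
    offset Q e (fun x => Real.sinh (ρ x + δ)) (fun x => Real.cosh (ρ x + δ)) w -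
      offset Q e (fun x => Real.sinh (ρ x + δ)) (fun x => Real.cosh (ρ x + δ)) v =
    edgeFactor ρ δ v w * (offset Q e (fun x => Real.sinh (ρ x)) (fun x => Real.cosh (ρ x)) w -
      offset Q e (fun x => Real.sinh (ρ x)) (fun x => Real.cosh (ρ x)) v)) ?_ ?_ ?_ ?_ ?_
  · intro x y hxy
    rw [edgeFactor_comm]
    linear_combination -hxy
  · have hm := coshSinh_div_mul (ρ Q) (ρ (Q.1 + 1, Q.2)) δ
    rw [show coshSinh ((ρ Q + ρ (Q.1 + 1, Q.2)) / 2 + δ) / coshSinh ((ρ Q + ρ (Q.1 + 1, Q.2)) / 2) =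
        edgeFactor ρ δ Q (Q.1 + 1, Q.2) by simp [edgeFactor]] at hm
    simp only [offset, add_eq_left, one_ne_zero, if_true, if_false]
    linear_combination (-I * e) * hm + e * (edgeFactor ρ δ Q (Q.1 + 1, Q.2) * Real.sinh (ρ Q) -
      Real.sinh (ρ Q + δ)) * I_sq
  · have hm := conj_coshSinh_div_mul (ρ (Q.1 + 1, Q.2 + 1)) (ρ (Q.1 + 1, Q.2)) δ
    rw [show conj (coshSinh ((ρ (Q.1 + 1, Q.2 + 1) + ρ (Q.1 + 1, Q.2)) / 2 + δ) / coshSinh ((ρ (Q.1 + 1, Q.2 + 1) + ρ (Q.1 + 1, Q.2)) / 2)) =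
        edgeFactor ρ δ (Q.1 + 1, Q.2 + 1) (Q.1 + 1, Q.2) by simp [edgeFactor]] at hm
    simp only [offset, add_eq_left, one_ne_zero, if_true, if_false]
    linear_combination (-I * e) * hm + -e * (edgeFactor ρ δ (Q.1 + 1, Q.2 + 1) (Q.1 + 1, Q.2) * Real.sinh (ρ (Q.1 + 1, Q.2 + 1)) -
      Real.sinh (ρ (Q.1 + 1, Q.2 + 1) + δ)) * I_sq
  · have hm := coshSinh_div_mul (ρ (Q.1 + 1, Q.2 + 1)) (ρ (Q.1, Q.2 + 1)) δ
    rw [show coshSinh ((ρ (Q.1 + 1, Q.2 + 1) + ρ (Q.1, Q.2 + 1)) / 2 + δ) / coshSinh ((ρ (Q.1 + 1, Q.2 + 1) + ρ (Q.1, Q.2 + 1)) / 2) =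
        edgeFactor ρ δ (Q.1 + 1, Q.2 + 1) (Q.1, Q.2 + 1) by simp [edgeFactor]] at hm
    simp only [offset, add_eq_left, one_ne_zero, if_true, if_false]
    linear_combination (I * e) * hm + -e * (edgeFactor ρ δ (Q.1 + 1, Q.2 + 1) (Q.1, Q.2 + 1) * Real.sinh (ρ (Q.1 + 1, Q.2 + 1)) -
      Real.sinh (ρ (Q.1 + 1, Q.2 + 1) + δ)) * I_sq
  · have hm := conj_coshSinh_div_mul (ρ Q) (ρ (Q.1, Q.2 + 1)) δ
    rw [show conj (coshSinh ((ρ Q + ρ (Q.1, Q.2 + 1)) / 2 + δ) / coshSinh ((ρ Q + ρ (Q.1, Q.2 + 1)) / 2)) =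
        edgeFactor ρ δ Q (Q.1, Q.2 + 1) by simp [edgeFactor]] at hm
    simp only [offset, add_eq_left, one_ne_zero, if_true, if_false]
    linear_combination (I * e) * hm + e * (edgeFactor ρ δ Q (Q.1, Q.2 + 1) * Real.sinh (ρ Q) -
      Real.sinh (ρ Q + δ)) * I_sq

/-- Passing from a ring pattern to one with shifted `ρ`-radii multiplies the vector of each edge
of a square by `edgeFactor`, up to a rotation. -/
lemma IsFrame.sub_eq_shift {S : Set (ℤ × ℤ)} {ρ : ℤ × ℤ → ℝ} {δ : ℝ} {P P' : Rings}
    (hρ : HasRhoRadii S P 1 ρ) (hρ' : HasRhoRadii S P' 1 (fun v => ρ v + δ)) {Q : ℤ × ℤ}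
    (hQ : Q ∈ S) {p e p' u : ℂ} (h : IsFrame Q p e P.center P.inner P.outer)
    (h' : IsFrame Q p' (u * e) P'.center P'.inner P'.outer) {v w : ℤ × ℤ}
    (hv : v ∈ corners Q) (hw : w ∈ corners Q) (hvw : grid.Adj v w) :
    P'.center w - P'.center v =
      u * (edgeFactor ρ δ v w * (P.center w - P.center v)) := by
  have hz : ∀ x ∈ corners Q, P.center x =
      p + offset Q e (fun x => Real.sinh (ρ x)) (fun x => Real.cosh (ρ x)) x := fun x hx => by
    obtain ⟨h1, h2⟩ := hρ x (corners_subset_vertices hQ hx)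
    rw [h x hx]
    exact congrArg _ (offset_congr (by rw [h1, one_mul]) (by rw [h2, one_mul]))
  have hz' : ∀ x ∈ corners Q, P'.center x = p' +
      u * offset Q e (fun x => Real.sinh (ρ x + δ)) (fun x => Real.cosh (ρ x + δ)) x :=
    fun x hx => by
      obtain ⟨h1, h2⟩ := hρ' x (corners_subset_vertices hQ hx)
      rw [h' x hx, ← offset_mul]
      exact congrArg _ (offset_congr (by rw [h1, one_mul]) (by rw [h2, one_mul]))
  have := offset_sub_offset_shift ρ δ e hv hw hvw
  rw [hz v hv, hz w hw, hz' v hv, hz' w hw]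
  linear_combination u * this

/-! ### Integration along edge paths -/

/-- The sum of `f` over the edges of a path. -/
def pathSum {G : SimpleGraph (ℤ × ℤ)} (f : ℤ × ℤ → ℤ × ℤ → ℂ) {u v : ℤ × ℤ} (p : G.Walk u v) :
    ℂ := (p.darts.map fun d => f d.fst d.snd).sum

lemma pathSum_append {G : SimpleGraph (ℤ × ℤ)} (f : ℤ × ℤ → ℤ × ℤ → ℂ) {u v w : ℤ × ℤ}
    (p : G.Walk u v) (q : G.Walk v w) : pathSum f (p.append q) = pathSum f p + pathSum f q := by
  simp [pathSum]

lemma pathSum_eq_sub {G : SimpleGraph (ℤ × ℤ)} {f : ℤ × ℤ → ℤ × ℤ → ℂ} {g : ℤ × ℤ → ℂ}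
    {A : Set (ℤ × ℤ)} (hf : ∀ v ∈ A, ∀ w ∈ A, G.Adj v w → f v w = g w - g v) {u v : ℤ × ℤ}
    (p : G.Walk u v) (hp : ∀ x ∈ p.support, x ∈ A) : pathSum f p = g v - g u := by
  induction p with
  | nil => simp [pathSum]
  | cons h q ih =>
    simp only [SimpleGraph.Walk.support_cons, List.mem_cons, forall_eq_or_imp] at hp
    have := ih hp.2
    simp only [pathSum, SimpleGraph.Walk.darts_cons, List.map_cons, List.sum_cons] at this ⊢
    rw [this, hf _ hp.1 _ (hp.2 _ q.start_mem_support) h]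
    ring

/-- Along a closed path in one square the sum telescopes through the local potential `g`; the other
generators of homotopy respect sums. -/
lemma Homotopic.pathSum_eq {S : Set (ℤ × ℤ)} {f : ℤ × ℤ → ℤ × ℤ → ℂ}
    (hf : ∀ Q ∈ S, ∃ g : ℤ × ℤ → ℂ, ∀ v ∈ corners Q, ∀ w ∈ corners Q, grid.Adj v w →
      f v w = g w - g v) {u v : ℤ × ℤ} {p q : (skeleton S).Walk u v} (h : Homotopic S p q) :
    pathSum f p = pathSum f q := by
  induction h with
  | refl => rfl
  | symm _ ih => exact ih.symm
  | trans _ _ ih₁ ih₂ => exact ih₁.trans ih₂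
  | append _ _ ih₁ ih₂ => rw [pathSum_append, pathSum_append, ih₁, ih₂]
  | square Q hQ p hp =>
    obtain ⟨g, hg⟩ := hf Q hQ
    rw [pathSum_eq_sub (G := skeleton S) (g := g) (fun v hv w hw h => hg v hv w hw h.1) p hp, sub_self]
    simp [pathSum]

/-- On a simply connected complex, an edge function that is closed on each square is exact. -/
lemma SimplyConnected.exists_potential {S : Set (ℤ × ℤ)} (hS : SimplyConnected S)
    {f : ℤ × ℤ → ℤ × ℤ → ℂ}
    (hf : ∀ Q ∈ S, ∃ g : ℤ × ℤ → ℂ, ∀ v ∈ corners Q, ∀ w ∈ corners Q, grid.Adj v w →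
      f v w = g w - g v) :
    ∃ z : ℤ × ℤ → ℂ, ∀ v w, (skeleton S).Adj v w → f v w = z w - z v := by
  classical
  rcases (vertices S).eq_empty_or_nonempty with h0 | ⟨v₀, hv₀⟩
  · refine ⟨0, fun v w ⟨_, Q, hQ, hv, _⟩ => ?_⟩
    exact absurd (corners_subset_vertices hQ hv) (by simp [h0])
  have loop : ∀ (u : ℤ × ℤ) (p : (skeleton S).Walk u u), pathSum f p = 0 := fun u p => by
    rw [(hS.2 u p).pathSum_eq hf]; simp [pathSum]
  have walks : ∀ v, ∃ c : ℂ, ∀ p : (skeleton S).Walk v₀ v, pathSum f p = c := fun v => by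
    by_cases h : (skeleton S).Reachable v₀ v
    · obtain ⟨q⟩ := h
      refine ⟨pathSum f q, fun p => ?_⟩
      -- Closing both paths by the same return path makes its contribution cancel, so no
      -- antisymmetry of `f` is needed.
      have h1 := loop _ (p.append q.reverse)
      have h2 := loop _ (q.append q.reverse)
      rw [pathSum_append] at h1 h2
      linear_combination h1 - h2
    · exact ⟨0, fun p => absurd ⟨p⟩ h⟩
  choose z hz using walks
  refine ⟨z, fun v w hvw => ?_⟩
  obtain ⟨-, Q, hQ, hv, -⟩ := id hvw
  obtain ⟨p⟩ := hS.1 v₀ hv₀ v (corners_subset_vertices hQ hv)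
  have h1 := hz w (p.append (.cons hvw .nil))
  rw [pathSum_append, hz v p] at h1
  simp only [pathSum, SimpleGraph.Walk.darts_cons, SimpleGraph.Walk.darts_nil, List.map_cons,
    List.map_nil, List.sum_cons, List.sum_nil, add_zero] at h1
  linear_combination h1

/-- Functions with the same increments along the edges of a square differ by a constant. -/
lemma exists_eq_add_of_edges {Q : ℤ × ℤ} {z g : ℤ × ℤ → ℂ}
    (h : ∀ v ∈ corners Q, ∀ w ∈ corners Q, grid.Adj v w → z w - z v = g w - g v) :
    ∃ p : ℂ, ∀ v ∈ corners Q, z v = p + g v := by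
  refine ⟨z Q - g Q, forall_corners.2 ⟨by ring, ?_, ?_, ?_⟩⟩
  · have := h Q (by simp [corners]) (Q.1 + 1, Q.2) (by simp [corners]) (by simp [grid])
    linear_combination this
  · have h1 := h Q (by simp [corners]) (Q.1 + 1, Q.2) (by simp [corners]) (by simp [grid])
    have h2 := h (Q.1 + 1, Q.2) (by simp [corners]) (Q.1 + 1, Q.2 + 1) (by simp [corners])
      (by simp [grid])
    linear_combination h1 + h2
  · have := h Q (by simp [corners]) (Q.1, Q.2 + 1) (by simp [corners]) (by simp [grid])
    linear_combination this

/-- The edge vectors of `P₀` times `edgeFactor` are, in each square, those of a standard square with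
shifted radii. They are therefore closed, and their potential supplies the new centres. -/
lemma exists_shifted_pattern {S : Set (ℤ × ℤ)} (hS : SimplyConnected S) {ρ : ℤ × ℤ → ℝ}
    {P₀ : Rings} (hP : IsOrthogonalRingPattern S P₀) (hρ : HasRhoRadii S P₀ 1 ρ) (δ : ℝ) :
    ∃ P : Rings, IsOrthogonalRingPattern S P ∧ HasRhoRadii S P 1 (fun v => ρ v + δ) := by
  have hF : ∀ Q ∈ S, ∃ e : ℂ, ‖e‖ = 1 ∧ ∀ v ∈ corners Q, ∀ w ∈ corners Q, grid.Adj v w →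
      edgeFactor ρ δ v w * (P₀.center w - P₀.center v) =
      offset Q e (fun x => Real.sinh (ρ x + δ)) (fun x => Real.cosh (ρ x + δ)) w -
      offset Q e (fun x => Real.sinh (ρ x + δ)) (fun x => Real.cosh (ρ x + δ)) v := by
    intro Q hQ
    obtain ⟨p, e, he, h⟩ := hP.exists_frame hQ
    refine ⟨e, he, fun v hv w hw hvw => ?_⟩
    -- The comparison pattern is the standard square itself, with common point `0` and no rotation.
    have := h.sub_eq_shift hρ (δ := δ) (P' := ⟨offset Q e (fun x => Real.sinh (ρ x + δ))
      (fun x => Real.cosh (ρ x + δ)), fun x => Real.sinh (ρ x + δ),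
      fun x => Real.cosh (ρ x + δ)⟩) (fun v _ => by simp) hQ (p' := 0) (u := 1)
      (fun v _ => by simp) hv hw hvw
    rw [one_mul] at this
    exact this.symm
  obtain ⟨z, hz⟩ := hS.exists_potential
    (f := fun v w => edgeFactor ρ δ v w * (P₀.center w - P₀.center v))
    (fun Q hQ => (hF Q hQ).imp' _ fun e he => he.2)
  refine ⟨⟨z, fun x => Real.sinh (ρ x + δ), fun x => Real.cosh (ρ x + δ)⟩,
    isOrthogonalRingPattern_of_frames ?_ ?_ ?_, fun v _ => by simp⟩
  · intro v _
    linarith [Real.cosh_sq (ρ v + δ)]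
  · exact fun v _ => Real.cosh_pos _
  · intro Q hQ
    obtain ⟨e, he, h⟩ := hF Q hQ
    obtain ⟨p, hp⟩ := exists_eq_add_of_edges (z := z) fun v hv w hw hvw =>
      (hz v w ⟨hvw, Q, hQ, hv, hw⟩).symm.trans (h v hv w hw hvw)
    exact ⟨p, e, he, hp⟩

/-! ### Collapse -/

/-- In a family of ring patterns, the rotations of all squares agree. -/
lemma exists_common_rotation {S : Set (ℤ × ℤ)} (hS : EdgeConnected S) {ρ : ℤ × ℤ → ℝ} {δ : ℝ}
    {P P' : Rings} (hP' : IsOrthogonalRingPattern S P')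
    (hρ : HasRhoRadii S P 1 ρ) (hρ' : HasRhoRadii S P' 1 (fun v => ρ v + δ))
    {p e p' e' : ℤ × ℤ → ℂ} (he : ∀ Q ∈ S, ‖e Q‖ = 1) (he' : ∀ Q ∈ S, ‖e' Q‖ = 1)
    (h : ∀ Q ∈ S, IsFrame Q (p Q) (e Q) P.center P.inner P.outer)
    (h' : ∀ Q ∈ S, IsFrame Q (p' Q) (e' Q) P'.center P'.inner P'.outer) :
    ∃ u : Circle, ∀ Q ∈ S, u * e' Q = e Q := by
  rcases S.eq_empty_or_nonempty with rfl | ⟨Q₀, hQ₀⟩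
  · exact ⟨1, by simp⟩
  have e0 : ∀ Q ∈ S, e Q ≠ 0 := fun Q hQ h0 => by simpa [h0] using he Q hQ
  have e0' : ∀ Q ∈ S, e' Q ≠ 0 := fun Q hQ h0 => by simpa [h0] using he' Q hQ
  refine ⟨⟨e Q₀ / e' Q₀, by simp [Submonoid.unitSphere, he Q₀ hQ₀, he' Q₀ hQ₀]⟩, ?_⟩
  -- The quotient `e' Q / e Q` is the ratio of an edge vector of `P'` to `edgeFactor` times that of
  -- `P`. A shared edge gives the same ratio in both squares.
  have key : ∀ Q ∈ S, e' Q / e Q = e' Q₀ / e Q₀ := by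
    refine hS.induction hQ₀ rfl fun Q hQ Q' hQ' hQQ' ih => ?_
    rw [← ih]
    obtain ⟨v, w, hvw, h1, h2, h3, h4⟩ := exists_shared_edge hQQ'
    have d1 := (h Q hQ).sub_eq_shift hρ hρ' hQ (u := e' Q / e Q)
      (by rw [div_mul_cancel₀ _ (e0 Q hQ)]; exact h' Q hQ) h1 h2 hvw
    have d2 := (h Q' hQ').sub_eq_shift hρ hρ' hQ' (u := e' Q' / e Q')
      (by rw [div_mul_cancel₀ _ (e0 Q' hQ')]; exact h' Q' hQ') h3 h4 hvw
    -- By orthogonality the squared edge length is at least the square of an outer radius, which is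
    -- positive.
    have hne : P'.center w - P'.center v ≠ 0 := by
      intro h0
      have := ((hP'.orthogonal v w ⟨hvw, Q, hQ, h1, h2⟩).2).norm_sub_sq
      rw [norm_sub_rev, h0, norm_zero] at this
      have hw := (hρ' w (corners_subset_vertices hQ h2)).2
      have := Real.cosh_pos (ρ w + δ)
      nlinarith
    have hne' : edgeFactor ρ δ v w * (P.center w - P.center v) ≠ 0 := by
      intro h0
      rw [h0, mul_zero] at d1
      exact hne d1
    exact mul_right_cancel₀ hne' (d2.symm.trans d1)
  intro Q hQ
  have h1 := (div_eq_div_iff (e0 Q hQ) (e0 Q₀ hQ₀)).1 (key Q hQ)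
  show e Q₀ / e' Q₀ * e' Q = e Q
  rw [div_mul_eq_mul_div, div_eq_iff (e0' Q₀ hQ₀)]
  linear_combination h1

/-- If the squares of a family of rings keep their direction, one of them is anchored, and the
scaled radii converge, then the scaled centres converge. -/
lemma exists_limit_centers {S : Set (ℤ × ℤ)} (hS : EdgeConnected S) {l : Filter ℝ}
    {z : ℝ → ℤ × ℤ → ℂ} {r R : ℝ → ℤ × ℤ → ℝ} {p : ℝ → ℤ × ℤ → ℂ} {e : ℤ × ℤ → ℂ} {c : ℝ → ℝ}
    {a b : ℤ × ℤ → ℝ} (h : ∀ δ, ∀ Q ∈ S, IsFrame Q (p δ Q) (e Q) (z δ) (r δ) (R δ))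
    (hr : ∀ v ∈ vertices S, Tendsto (fun δ => c δ * r δ v) l (𝓝 (a v)))
    (hR : ∀ v ∈ vertices S, Tendsto (fun δ => c δ * R δ v) l (𝓝 (b v)))
    (anchor : ∃ Q₀ ∈ S, ∀ δ, p δ Q₀ = 0) [l.NeBot] :
    ∃ ζ : ℤ × ℤ → ℂ, (∀ v ∈ vertices S, Tendsto (fun δ => (c δ : ℂ) * z δ v) l (𝓝 (ζ v))) ∧
      ∀ Q ∈ S, ∃ q, IsFrame Q q (e Q) ζ a b := by
  obtain ⟨Q₀, hQ₀, h0⟩ := anchor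
  have off : ∀ Q ∈ S, ∀ v ∈ corners Q, Tendsto
      (fun δ => (c δ : ℂ) * offset Q (e Q) (r δ) (R δ) v) l (𝓝 (offset Q (e Q) a b v)) :=
    fun Q hQ v hv => tendsto_offset Q (e Q) (hr v (corners_subset_vertices hQ hv))
      (hR v (corners_subset_vertices hQ hv))
  have vertex : ∀ Q ∈ S, ∀ v ∈ corners Q, ∀ q : ℂ,
      Tendsto (fun δ => (c δ : ℂ) * p δ Q) l (𝓝 q) →
      Tendsto (fun δ => (c δ : ℂ) * z δ v) l (𝓝 (q + offset Q (e Q) a b v)) :=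
    fun Q hQ v hv q hq => by
      refine (hq.add (off Q hQ v hv)).congr fun δ => ?_
      rw [h δ Q hQ v hv, mul_add]
  have points : ∀ Q ∈ S, ∃ q : ℂ, Tendsto (fun δ => (c δ : ℂ) * p δ Q) l (𝓝 q) := by
    refine hS.induction hQ₀ ⟨0, by simp [h0]⟩ ?_
    rintro Q hQ Q' hQ' hQQ' ⟨q, hq⟩
    obtain ⟨v, -, -, h1, -, h3, -⟩ := exists_shared_edge hQQ'
    -- A shared vertex carries convergence over: the new common point is that vertex minus its
    -- offset in `Q'`.
    refine ⟨_, ((vertex Q hQ v h1 q hq).sub (off Q' hQ' v h3)).congr fun δ => ?_⟩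
    rw [h δ Q' hQ' v h3]
    ring
  have centers : ∀ v, ∃ x : ℂ, v ∈ vertices S →
      Tendsto (fun δ => (c δ : ℂ) * z δ v) l (𝓝 x) := fun v => by
    by_cases hv : v ∈ vertices S
    · obtain ⟨Q, hQ, hvQ⟩ := id hv
      obtain ⟨q, hq⟩ := points Q hQ
      exact ⟨_, fun _ => vertex Q hQ v hvQ q hq⟩
    · exact ⟨0, fun h => absurd h hv⟩
  choose ζ hζ using centers
  refine ⟨ζ, hζ, fun Q hQ => ?_⟩
  obtain ⟨q, hq⟩ := points Q hQ
  exact ⟨q, fun v hv => tendsto_nhds_unique (hζ v (corners_subset_vertices hQ hv))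
    (vertex Q hQ v hv q hq)⟩

/-! ### Limits of the scaled radii. -/

lemma tendsto_exp_two_mul_add_atBot (x : ℝ) :
    Tendsto (fun δ => Real.exp (x + 2 * δ)) atBot (𝓝 0) :=
  Real.tendsto_exp_atBot.comp
    (tendsto_atBot_add_const_left _ x (tendsto_id.const_mul_atBot two_pos))

lemma tendsto_exp_neg_sub_atTop (x : ℝ) :
    Tendsto (fun δ => Real.exp (-x - 2 * δ)) atTop (𝓝 0) := by
  have := (tendsto_exp_two_mul_add_atBot (-x)).comp tendsto_neg_atTop_atBot
  refine this.congr fun δ => ?_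
  simp only [Function.comp_apply]
  ring_nf

lemma tendsto_scaled_sinh_atTop (x : ℝ) :
    Tendsto (fun δ => 2 * Real.exp (-|δ|) * Real.sinh (x + δ)) atTop (𝓝 (Real.exp x)) := by
  -- For `δ ≥ 0` the scaled radius equals `exp x - exp (-x - 2 δ)`.
  have := (tendsto_exp_neg_sub_atTop x).const_sub (Real.exp x)
  rw [sub_zero] at this
  refine this.congr' ?_
  filter_upwards [eventually_ge_atTop 0] with δ hδ
  rw [abs_of_nonneg hδ, Real.sinh_eq]
  have h1 : Real.exp x = Real.exp (-δ) * Real.exp (x + δ) := by rw [← Real.exp_add]; ring_nf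
  have h2 : Real.exp (-x - 2 * δ) = Real.exp (-δ) * Real.exp (-(x + δ)) := by
    rw [← Real.exp_add]; ring_nf
  rw [h1, h2]; ring

lemma tendsto_scaled_cosh_atTop (x : ℝ) :
    Tendsto (fun δ => 2 * Real.exp (-|δ|) * Real.cosh (x + δ)) atTop (𝓝 (Real.exp x)) := by
  have := (tendsto_exp_neg_sub_atTop x).const_add (Real.exp x)
  rw [add_zero] at this
  refine this.congr' ?_
  filter_upwards [eventually_ge_atTop 0] with δ hδ
  rw [abs_of_nonneg hδ, Real.cosh_eq]
  have h1 : Real.exp x = Real.exp (-δ) * Real.exp (x + δ) := by rw [← Real.exp_add]; ring_nf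
  have h2 : Real.exp (-x - 2 * δ) = Real.exp (-δ) * Real.exp (-(x + δ)) := by
    rw [← Real.exp_add]; ring_nf
  rw [h1, h2]; ring

lemma tendsto_scaled_sinh_atBot (x : ℝ) :
    Tendsto (fun δ => 2 * Real.exp (-|δ|) * Real.sinh (x + δ)) atBot (𝓝 (-Real.exp (-x))) := by
  refine ((tendsto_scaled_sinh_atTop (-x)).comp tendsto_neg_atBot_atTop).neg.congr fun δ => ?_
  simp only [Function.comp_apply, abs_neg]
  rw [← neg_add, Real.sinh_neg, mul_neg, neg_neg]

lemma tendsto_scaled_cosh_atBot (x : ℝ) :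
    Tendsto (fun δ => 2 * Real.exp (-|δ|) * Real.cosh (x + δ)) atBot (𝓝 (Real.exp (-x))) := by
  refine ((tendsto_scaled_cosh_atTop (-x)).comp tendsto_neg_atBot_atTop).congr fun δ => ?_
  simp only [Function.comp_apply, abs_neg]
  rw [← neg_add, Real.cosh_neg]

lemma IsFrame.move {Q : ℤ × ℤ} {p e : ℂ} {P : Rings}
    (h : IsFrame Q p e P.center P.inner P.outer) (u : Circle) (t : ℂ) :
    IsFrame Q (u * p + t) (u * e) (P.move u t).center P.inner P.outer := fun v hv => by
  simp only [Rings.move, h v hv, offset_mul]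
  ring

/-- Complex conjugation turns a frame with negative inner radii into one with positive radii. -/
lemma IsFrame.conj {Q : ℤ × ℤ} {p e : ℂ} {z : ℤ × ℤ → ℂ} {s : ℤ × ℤ → ℝ}
    (h : IsFrame Q p e z (fun v => -s v) s) :
    IsFrame Q (conj p) (-conj e) (fun v => conj (z v)) s s := by
  -- The direction becomes `-conj e` because `conj (i e) = i (-conj e)` keeps the outer centres in
  -- place, while `-s conj e = s (-conj e)` makes the inner radii positive.
  rw [isFrame_iff] at h ⊢
  obtain ⟨h1, h2, h3, h4⟩ := h
  simp [h1, h2, h3, h4]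

end RingPattern

/-! ### The circle pattern and its dual as limits of the family. -/

open RingPattern in
theorem corollary2 (S : Set (ℤ × ℤ)) (hS : RingPattern.EdgeConnected S) (ρ : ℤ × ℤ → ℝ) :
    (RingPattern.SimplyConnected S →
      ∀ P₀ : RingPattern.Rings, RingPattern.IsOrthogonalRingPattern S P₀ →
        RingPattern.HasRhoRadii S P₀ 1 ρ →
        ∃ P : ℝ → RingPattern.Rings, P 0 = P₀ ∧ RingPattern.IsRingFamily S ρ P) ∧
    ∀ P : ℝ → RingPattern.Rings, RingPattern.IsRingFamily S ρ P →
      ∃ K K' : RingPattern.Circles,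
        RingPattern.IsOrthogonalCirclePattern S K ∧ RingPattern.HasLogRadii S K ρ ∧
        RingPattern.IsDual S K K' ∧ RingPattern.HasLogRadii S K' (fun v => -ρ v) ∧
        ∃ (u : ℝ → Circle) (t : ℝ → ℂ),
          RingPattern.CollapsesTo S Filter.atTop
            (fun δ => ((P δ).move (u δ) (t δ)).scale (2 * Real.exp (-|δ|))) K ∧
          RingPattern.CollapsesTo S Filter.atBot
            (fun δ => ((P δ).move (u δ) (t δ)).scale (2 * Real.exp (-|δ|))) K'.reverse := by
  classical
  constructor
  · intro hSC P₀ hP₀ hρ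
    choose P hP using exists_shifted_pattern hSC hP₀ hρ
    -- The pattern chosen at `δ = 0` has the right radii but may differ from `P₀`, so it is
    -- replaced.
    refine ⟨fun δ => if δ = 0 then P₀ else P δ, by simp, fun δ => ?_⟩
    by_cases hδ : δ = 0
    · simpa [hδ] using ⟨hP₀, hρ⟩
    · simpa [hδ] using hP δ
  intro P hP
  rcases S.eq_empty_or_nonempty with rfl | ⟨Q₀, hQ₀⟩
  · have hV : ∀ v, v ∉ vertices ∅ := by simp [vertices]
    have hK : IsOrthogonalCirclePattern ∅ ⟨0, 0⟩ :=
      isOrthogonalCirclePattern_of_frames (fun v hv => absurd hv (hV v)) (by simp)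
    exact ⟨⟨0, 0⟩, ⟨0, 0⟩, hK, fun v hv => absurd hv (hV v),
      ⟨hK, hK, fun v hv => absurd hv (hV v)⟩, fun v hv => absurd hv (hV v), 1, 0,
      fun v hv => absurd hv (hV v), fun v hv => absurd hv (hV v)⟩
  have frames : ∀ δ Q, ∃ p e : ℂ, Q ∈ S →
      ‖e‖ = 1 ∧ IsFrame Q p e (P δ).center (P δ).inner (P δ).outer := fun δ Q => by
    by_cases hQ : Q ∈ S
    · obtain ⟨p, e, h⟩ := (hP δ).1.exists_frame hQ
      exact ⟨p, e, fun _ => h⟩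
    · exact ⟨0, 0, fun h => absurd h hQ⟩
  choose p e hpe using frames
  have hρ₀ : HasRhoRadii S (P 0) 1 ρ := by simpa using (hP 0).2
  have rot : ∀ δ, ∃ u : Circle, ∀ Q ∈ S, u * e δ Q = e 0 Q := fun δ =>
    exists_common_rotation hS (hP δ).1 hρ₀ (hP δ).2 (fun Q hQ => (hpe 0 Q hQ).1)
      (fun Q hQ => (hpe δ Q hQ).1) (fun Q hQ => (hpe 0 Q hQ).2) (fun Q hQ => (hpe δ Q hQ).2)
  choose u hu using rot
  -- The translation puts the common point of `Q₀` at the origin for every `δ`.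
  obtain ⟨t, ht⟩ : ∃ t : ℝ → ℂ, ∀ δ, u δ * p δ Q₀ + t δ = 0 :=
    ⟨fun δ => -(u δ * p δ Q₀), fun δ => by ring⟩
  have hF : ∀ δ, ∀ Q ∈ S, IsFrame Q (u δ * p δ Q + t δ) (e 0 Q)
      ((P δ).move (u δ) (t δ)).center (P δ).inner (P δ).outer := fun δ Q hQ => by
    rw [← hu δ Q hQ]
    exact (hpe δ Q hQ).2.move (u δ) (t δ)
  have inner_eq : ∀ v ∈ vertices S, ∀ δ, (P δ).inner v = Real.sinh (ρ v + δ) :=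
    fun v hv δ => by rw [((hP δ).2 v hv).1, one_mul]
  have outer_eq : ∀ v ∈ vertices S, ∀ δ, (P δ).outer v = Real.cosh (ρ v + δ) :=
    fun v hv δ => by rw [((hP δ).2 v hv).2, one_mul]
  have rT : ∀ v ∈ vertices S, Tendsto (fun δ => 2 * Real.exp (-|δ|) * (P δ).inner v) atTop
      (𝓝 (Real.exp (ρ v))) := fun v hv => by
    simp only [inner_eq v hv]; exact tendsto_scaled_sinh_atTop _
  have RT : ∀ v ∈ vertices S, Tendsto (fun δ => 2 * Real.exp (-|δ|) * (P δ).outer v) atTop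
      (𝓝 (Real.exp (ρ v))) := fun v hv => by
    simp only [outer_eq v hv]; exact tendsto_scaled_cosh_atTop _
  have rB : ∀ v ∈ vertices S, Tendsto (fun δ => 2 * Real.exp (-|δ|) * (P δ).inner v) atBot
      (𝓝 (-Real.exp (-ρ v))) := fun v hv => by
    simp only [inner_eq v hv]; exact tendsto_scaled_sinh_atBot _
  have RB : ∀ v ∈ vertices S, Tendsto (fun δ => 2 * Real.exp (-|δ|) * (P δ).outer v) atBot
      (𝓝 (Real.exp (-ρ v))) := fun v hv => by
    simp only [outer_eq v hv]; exact tendsto_scaled_cosh_atBot _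
  obtain ⟨z, hz, hzF⟩ := exists_limit_centers hS hF rT RT ⟨Q₀, hQ₀, ht⟩
  obtain ⟨z', hz', hzF'⟩ := exists_limit_centers hS hF rB RB ⟨Q₀, hQ₀, ht⟩
  have hK : IsOrthogonalCirclePattern S ⟨z, fun v => Real.exp (ρ v)⟩ :=
    isOrthogonalCirclePattern_of_frames (fun v _ => Real.exp_pos _) fun Q hQ => by
      obtain ⟨q, hq⟩ := hzF Q hQ
      exact ⟨q, e 0 Q, (hpe 0 Q hQ).1, hq⟩
  -- The limit at `-∞` has inner radii `-exp (-ρ)`; its mirror image is the dual pattern, and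
  -- `reverse` undoes the reflection.
  have hK' : IsOrthogonalCirclePattern S ⟨fun v => conj (z' v), fun v => Real.exp (-ρ v)⟩ :=
    isOrthogonalCirclePattern_of_frames (fun v _ => Real.exp_pos _) fun Q hQ => by
      obtain ⟨q, hq⟩ := hzF' Q hQ
      exact ⟨conj q, -conj (e 0 Q), by simpa using (hpe 0 Q hQ).1, hq.conj⟩
  refine ⟨_, _, hK, fun v _ => rfl, ⟨hK, hK', fun v _ => Real.exp_neg _⟩, fun v _ => rfl, u, t,
    fun v hv => ⟨?_, rT v hv, ?_⟩, fun v hv => ⟨?_, rB v hv, ?_⟩⟩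
  · simpa [Rings.scale] using hz v hv
  · simpa [Rings.scale, Rings.move] using RT v hv
  · simpa [Rings.scale, Circles.reverse] using hz' v hv
  · simpa [Rings.scale, Rings.move, Circles.reverse] using RB v hv
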